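/- Let $\mathcal{F}$ be the set of nondecreasing, right-continuous functions $\mathbb{R}\to\mathbb{R}$, with the topology of weak convergence (pointwise convergence at the continuity points of the limit) and its Borel $\sigma$-algebra, and let $\mathcal{F}_0\subseteq\mathcal{F}$ be the set of cumulative distribution functions (CDFs), i.e. of those $G\in\mathcal{F}$ with $\lim_{x\to-\infty}G(x)=0$ and $\lim_{x\to\infty}G(x)=1$. For $\underline F,\overline F\in\mathcal{F}$ let $$\mathcal{I}(\underline F,\overline F)=\{H\in\mathcal{F} : \underline F(x)\le H(x)\le \overline F(x)\ \text{for all } x\in\mathbb{R}\}.$$ Fix a prior $F\in\mathcal{F}_0$ and $\tau\in(0,1)$. A signal is a probability measure $\mu$ on $\mathcal{F}_0$ such that $\int_{\mathcal{F}_0}G(\omega)\,\mu(dG)=F(\omega)$ for all $\omega\in\mathbb{R}$. For $G\in\mathcal{F}_0$ let $G^{-1}(p)=\inf\{x\in\mathbb{R}: G(x)\ge p\}$ and $G^{-1}(\tau^+)=\lim_{q\downarrow\tau}G^{-1}(q)$. A $\tau$-quantile selection rule is a transition probability $r$ from $\mathcal{F}_0$ to $\mathbb{R}$ such that, for every $G\in\mathcal{F}_0$,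 $r(\cdot\mid G)$ assigns probability $1$ to the set $[G^{-1}(\tau),G^{-1}(\tau^+)]$ of $\tau$-quantiles of $G$. A signal $\mu$ and a $\tau$-quantile selection rule $r$ induce the distribution of posterior $\tau$-quantiles with CDF $$H^\tau(\omega\mid\mu,r)=\int_{\mathcal{F}_0} r\big((-\infty,\omega]\mid G\big)\,\mu(dG),\qquad \omega\in\mathbb{R},$$ and $\mathcal{H}_\tau$ denotes the set of all $H^\tau(\cdot\mid\mu,r)$, where $\mu$ ranges over the signals and $r$ over the $\tau$-quantile selection rules. Then $$\mathcal{H}_\tau=\mathcal{I}(F_R^\tau,F_L^\tau),$$ where $F_L^\tau(\omega)=\min\{F(\omega)/\tau,\,1\}$ and $F_R^\tau(\omega)=\max\{(F(\omega)-\tau)/(1-\tau),\,0\}$ are the left and right truncations of $F$. -/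

import Mathlib

open MeasureTheory ProbabilityTheory Set Filter Topology

noncomputable section

namespace PosteriorQuantile

/-- The set of nondecreasing, right-continuous functions `ℝ → ℝ`. -/
abbrev MonoFun : Type := StieltjesFunction ℝ

/-- Weak convergence: pointwise convergence at every continuity point of the limit. -/
def WeakConv (u : ℕ → MonoFun) (G : MonoFun) : Prop :=
  ∀ x : ℝ, ContinuousAt (fun y : ℝ => G y) x → Tendsto (fun n => u n x) atTop (𝓝 (G x))

/-- The topology defined by weak convergence: a set is open iff every sequence converging weakly
to one of its points is eventually in it (equivalently, a set is closed iff it contains all weak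
limits of sequences of its points). -/
instance instTopologicalSpaceMonoFun : TopologicalSpace MonoFun where
  IsOpen U := ∀ G ∈ U, ∀ u : ℕ → MonoFun, WeakConv u G → ∀ᶠ n in atTop, u n ∈ U
  isOpen_univ := fun _ _ _ _ => Eventually.of_forall fun _ => mem_univ _
  isOpen_inter := fun _ _ hs ht G hG u hu => (hs G hG.1 u hu).and (ht G hG.2 u hu)
  isOpen_sUnion := fun _ hS G ⟨t, htS, hGt⟩ u hu =>
    (hS t htS G hGt u hu).mono fun _ hn => ⟨t, htS, hn⟩

/-- The Borel σ-algebra of the topology of weak convergence. -/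
instance instMeasurableSpaceMonoFun : MeasurableSpace MonoFun := borel MonoFun

instance instBorelSpaceMonoFun : BorelSpace MonoFun := ⟨rfl⟩

/-- Cumulative distribution functions on `ℝ`, with the subspace topology and its
Borel σ-algebra. -/
abbrev CDF : Type :=
  {G : MonoFun // Tendsto (fun x : ℝ => G x) atTop (𝓝 1) ∧
    Tendsto (fun x : ℝ => G x) atBot (𝓝 0)}

/-- The interval of monotone functions between `Flow` and `Fup`. -/
def interval (Flow Fup : MonoFun) : Set MonoFun :=
  {H | ∀ x : ℝ, Flow x ≤ H x ∧ H x ≤ Fup x}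

/-- The set of signals for the prior `F`: probability measures over posterior CDFs whose mean
is the prior. -/
def signals (F : CDF) : Set (ProbabilityMeasure CDF) :=
  {μ | ∀ ω : ℝ, ∫ G : CDF, G.1 ω ∂(μ : Measure CDF) = F.1 ω}

/-- The quantile function of `G`. -/
def quantile (G : CDF) (p : ℝ) : ℝ := sInf {x : ℝ | p ≤ G.1 x}

/-- The set of `τ`-quantiles of `G`; `Function.rightLim` is the right limit, which exists at
every `τ ∈ (0,1)` since the quantile function is nondecreasing on `(0,1)`. -/
def quantileSet (τ : ℝ) (G : CDF) : Set ℝ :=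
  Icc (quantile G τ) (Function.rightLim (quantile G) τ)

/-- The `τ`-quantile selection rules: transition probabilities from CDFs to `ℝ` that assign,
for every CDF, probability one to its set of `τ`-quantiles. -/
def selectionRules (τ : ℝ) : Set (Kernel CDF ℝ) :=
  {r | IsMarkovKernel r ∧ ∀ G : CDF, r G (quantileSet τ G) = 1}

/-- The CDF of the selected quantile when the posterior is drawn from `μ` and, given the
posterior `G`, the quantile is drawn from `r G`. -/
def inducedDistribution (μ : ProbabilityMeasure CDF) (r : Kernel CDF ℝ) : MonoFun :=
  cdf ((μ : Measure CDF).bind r)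

/-- The distributions of posterior `τ`-quantiles induced by some signal and selection rule. -/
def quantileDistributions (F : CDF) (τ : ℝ) : Set MonoFun :=
  {H | ∃ μ ∈ signals F, ∃ r ∈ selectionRules τ, H = inducedDistribution μ r}

/-- The left truncation `min {F / τ, 1}`. -/
def leftTruncation (F : CDF) (τ : ℝ) (hτ : τ ∈ Ioo (0 : ℝ) 1) : MonoFun where
  toFun ω := min (1 / τ * F.1 ω) 1
  mono' := fun _ _ hxy =>
    min_le_min_right 1
      (mul_le_mul_of_nonneg_left (F.1.mono hxy) (one_div_nonneg.2 hτ.1.le))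
  right_continuous' := fun x =>
    (continuousWithinAt_const.mul (F.1.right_continuous x)).min continuousWithinAt_const

/-- The right truncation `max {(F - τ) / (1 - τ), 0}`. -/
def rightTruncation (F : CDF) (τ : ℝ) (hτ : τ ∈ Ioo (0 : ℝ) 1) : MonoFun where
  toFun ω := max ((F.1 ω - τ) / (1 - τ)) 0
  mono' := fun _ _ hxy =>
    max_le_max_right 0
      (div_le_div_of_nonneg_right (sub_le_sub_right (F.1.mono hxy) τ) (sub_nonneg.2 hτ.2.le))
  right_continuous' := fun x =>
    (((F.1.right_continuous x).sub continuousWithinAt_const).div_const _).max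
      continuousWithinAt_const

end PosteriorQuantile

end

namespace PosteriorQuantile

/-! Necessity is pointwise in the posterior `G`. If `G ω < τ`, no `τ`-quantile lies in `Iic ω`; if
`G ω > τ`, all of them do. Hence the selected mass of `Iic ω` lies between `(G ω - τ) / (1 - τ)` and
`G ω / τ`, and averaging over the signal replaces `G` by `F`. For sufficiency, draw `u` uniformly
from `(0,1)`. Let `a`, `b`, `Y` be the `u`-quantiles of the left truncation, the right truncation
and `H`; the bounds on `H` say `a ≤ Y ≤ b`. The posterior with mass `τ` at `a` and `1 - τ` at `b`
has every point of `[a, b]` as a `τ`-quantile. Its mean is `τ * F_L + (1 - τ) * F_R = F`, and `Y`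
has law `H`. Since `Y` need not be a function of the posterior, the selection rule is its
conditional law (`exists_selectionRule`). -/

/-! ### Quantiles of a CDF -/

theorem quantile_le_iff (G : CDF) {p : ℝ} (hp : p ∈ Ioo (0 : ℝ) 1) (ω : ℝ) :
    quantile G p ≤ ω ↔ p ≤ G.1 ω := by
  obtain ⟨b, hb⟩ := (G.2.2.eventually (gt_mem_nhds hp.1)).exists
  have hbdd : BddBelow {x : ℝ | p ≤ G.1 x} := by
    refine ⟨b, fun x hx => ?_⟩
    by_contra! h
    exact absurd (hx.trans (G.1.mono h.le)) (not_le.2 hb)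
  obtain ⟨t, ht⟩ := (G.2.1.eventually (lt_mem_nhds hp.2)).exists
  have hne : {x : ℝ | p ≤ G.1 x}.Nonempty := ⟨t, ht.le⟩
  refine ⟨fun h => ?_, fun h => csInf_le hbdd h⟩
  have hgt : ∀ y, ω < y → p ≤ G.1 y := fun y hy => by
    obtain ⟨x, hx, hxy⟩ := (csInf_lt_iff hbdd hne).1 (h.trans_lt hy)
    exact le_trans hx (G.1.mono hxy.le)
  have hlim : Tendsto (fun y => G.1 y) (𝓝[>] ω) (𝓝 (G.1 ω)) :=
    (G.1.right_continuous ω).mono_left (nhdsWithin_mono _ Ioi_subset_Ici_self)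
  exact ge_of_tendsto hlim (eventually_nhdsWithin_of_forall hgt)

theorem monotoneOn_quantile (G : CDF) : MonotoneOn (quantile G) (Ioo 0 1) :=
  fun _ hp _ hq hpq =>
    (quantile_le_iff G hp _).2 (hpq.trans ((quantile_le_iff G hq _).1 le_rfl))

theorem tendsto_quantile_rightLim (G : CDF) {τ : ℝ} (hτ : τ ∈ Ioo (0 : ℝ) 1) :
    Tendsto (quantile G) (𝓝[>] τ) (𝓝 (Function.rightLim (quantile G) τ)) := by
  -- Outside `(0,1)` the infimum can take the default value `0`, so monotonicity is used only on
  -- `(τ, 1)`.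
  have hsub : Ioo τ 1 ⊆ Ioo (0 : ℝ) 1 := Ioo_subset_Ioo_left hτ.1.le
  have h := MonotoneOn.tendsto_nhdsWithin_Ioo_right (nonempty_Ioo.2 hτ.2)
    ((monotoneOn_quantile G).mono hsub)
    ⟨quantile G τ, by
      rintro _ ⟨q, hq, rfl⟩
      exact monotoneOn_quantile G hτ (hsub hq) hq.1.le⟩
  rwa [rightLim_eq_of_tendsto h]

theorem rightLim_quantile_le (G : CDF) {τ : ℝ} (hτ : τ ∈ Ioo (0 : ℝ) 1) {ω : ℝ}
    (h : τ < G.1 ω) : Function.rightLim (quantile G) τ ≤ ω := by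
  refine le_of_tendsto (tendsto_quantile_rightLim G hτ) ?_
  filter_upwards [Ioo_mem_nhdsGT h, Ioo_mem_nhdsGT hτ.2] with q hq hq1
  exact (quantile_le_iff G ⟨hτ.1.trans hq1.1, hq1.2⟩ _).2 hq.2.le

theorem le_rightLim_quantile (G : CDF) {τ : ℝ} (hτ : τ ∈ Ioo (0 : ℝ) 1) {b : ℝ}
    (h : ∀ ω < b, G.1 ω ≤ τ) : b ≤ Function.rightLim (quantile G) τ := by
  refine ge_of_tendsto (tendsto_quantile_rightLim G hτ) ?_
  filter_upwards [Ioo_mem_nhdsGT hτ.2] with q hq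
  by_contra! hlt
  have := (quantile_le_iff G ⟨hτ.1.trans hq.1, hq.2⟩ _).1 le_rfl
  linarith [h _ hlt, hq.1]

theorem quantile_le_rightLim (G : CDF) {τ : ℝ} (hτ : τ ∈ Ioo (0 : ℝ) 1) :
    quantile G τ ≤ Function.rightLim (quantile G) τ :=
  le_rightLim_quantile G hτ fun ω hω => by
    by_contra! h
    exact absurd ((quantile_le_iff G hτ ω).2 h.le) (not_le.2 hω)

/-! ### Measurability of evaluation and of quantiles -/

theorem CDF.nonneg (G : CDF) (ω : ℝ) : 0 ≤ G.1 ω := G.1.mono.le_of_tendsto G.2.2 ω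

theorem CDF.le_one (G : CDF) (ω : ℝ) : G.1 ω ≤ 1 := G.1.mono.ge_of_tendsto G.2.1 ω

/-- Evaluation at a point is upper semicontinuous for weak convergence. -/
theorem isOpen_eval_lt (x c : ℝ) : IsOpen {G : MonoFun | G x < c} := by
  intro G hG u hu
  have hlim : ∀ᶠ y in 𝓝[>] x, G y < c :=
    ((G.right_continuous x).mono_left (nhdsWithin_mono _ Ioi_subset_Ici_self)).eventually
      (gt_mem_nhds hG)
  obtain ⟨d, hxd, hd⟩ := mem_nhdsGT_iff_exists_Ioo_subset.1 hlim
  -- Weak convergence gives no information at a jump of `G`, so `x` is replaced by a nearby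
  -- continuity point on its right.
  have hcount := G.mono.countable_not_continuousAt
  obtain ⟨y, hy, hyc⟩ : ∃ y ∈ Ioo x d, ContinuousAt (fun z : ℝ => G z) y := by
    by_contra! h
    exact (Cardinal.Real.Ioo_countable_iff.not.2 (not_le.2 hxd)) (hcount.mono h)
  filter_upwards [(hu y hyc).eventually (gt_mem_nhds (hd hy))] with n hn
  exact ((u n).mono hy.1.le).trans_lt hn

theorem measurable_eval (x : ℝ) : Measurable fun G : CDF => G.1 x :=
  (measurable_of_Iio fun c => (isOpen_eval_lt x c).measurableSet).comp measurable_subtype_coe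

theorem integrable_eval (μ : ProbabilityMeasure CDF) (ω : ℝ) :
    Integrable (fun G : CDF => G.1 ω) (μ : Measure CDF) :=
  Integrable.of_bound (measurable_eval ω).aestronglyMeasurable 1
    (Eventually.of_forall fun G => by
      rw [Real.norm_of_nonneg (G.nonneg ω)]; exact G.le_one ω)

theorem measurable_quantile {p : ℝ} (hp : p ∈ Ioo (0 : ℝ) 1) :
    Measurable fun G : CDF => quantile G p :=
  measurable_of_Iic fun ω => by
    have : (fun G : CDF => quantile G p) ⁻¹' Iic ω = (fun G : CDF => G.1 ω) ⁻¹' Ici p :=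
      Set.ext fun G => quantile_le_iff G hp ω
    rw [this]
    exact measurable_eval ω measurableSet_Ici

theorem measurable_rightLim_quantile {τ : ℝ} (hτ : τ ∈ Ioo (0 : ℝ) 1) :
    Measurable fun G : CDF => Function.rightLim (quantile G) τ := by
  obtain ⟨u, -, hu, hlim⟩ := exists_seq_strictAnti_tendsto' hτ.2
  have hu' : Tendsto u atTop (𝓝[>] τ) :=
    tendsto_nhdsWithin_iff.2 ⟨hlim, Eventually.of_forall fun n => (hu n).1⟩
  exact measurable_of_tendsto_metrizable
    (fun n => measurable_quantile ⟨hτ.1.trans (hu n).1, (hu n).2⟩)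
    (tendsto_pi_nhds.2 fun G => (tendsto_quantile_rightLim G hτ).comp hu')

theorem measurableSet_graph_quantileSet {τ : ℝ} (hτ : τ ∈ Ioo (0 : ℝ) 1) :
    MeasurableSet {p : CDF × ℝ | p.2 ∈ quantileSet τ p.1} :=
  (measurableSet_le ((measurable_quantile hτ).comp measurable_fst) measurable_snd).inter
    (measurableSet_le measurable_snd ((measurable_rightLim_quantile hτ).comp measurable_fst))

/-! ### Necessity of the bounds -/

theorem selection_Iic_le {τ : ℝ} (hτ : τ ∈ Ioo (0 : ℝ) 1) {r : Kernel CDF ℝ}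
    (hr : r ∈ selectionRules τ) (G : CDF) (ω : ℝ) :
    (r G).real (Iic ω) ≤ 1 / τ * G.1 ω := by
  have := hr.1
  rcases le_or_gt τ (G.1 ω) with h | h
  · refine measureReal_le_one.trans ?_
    rw [one_div, inv_mul_eq_div]
    exact (one_le_div hτ.1).2 h
  · have hdisj : Iic ω ⊆ (quantileSet τ G)ᶜ := fun x hx hxQ =>
      absurd ((quantile_le_iff G hτ ω).1 (hxQ.1.trans hx)) (not_le.2 h)
    have h0 : r G (quantileSet τ G)ᶜ = 0 := (prob_compl_eq_zero_iff measurableSet_Icc).2 (hr.2 G)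
    rw [measureReal_def, measure_mono_null hdisj h0, ENNReal.toReal_zero]
    exact mul_nonneg (one_div_nonneg.2 hτ.1.le) (G.nonneg ω)

theorem le_selection_Iic {τ : ℝ} (hτ : τ ∈ Ioo (0 : ℝ) 1) {r : Kernel CDF ℝ}
    (hr : r ∈ selectionRules τ) (G : CDF) (ω : ℝ) :
    (G.1 ω - τ) / (1 - τ) ≤ (r G).real (Iic ω) := by
  have := hr.1
  have hτ' : 0 < 1 - τ := sub_pos.2 hτ.2
  rcases lt_or_ge τ (G.1 ω) with h | h
  · have hsub : quantileSet τ G ⊆ Iic ω := fun x hx => hx.2.trans (rightLim_quantile_le G hτ h)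
    have h1 : r G (Iic ω) = 1 := le_antisymm prob_le_one ((hr.2 G).symm.le.trans (measure_mono hsub))
    rw [measureReal_def, h1, ENNReal.toReal_one, div_le_one hτ']
    linarith [G.le_one ω]
  · exact (div_nonpos_of_nonpos_of_nonneg (by linarith) hτ'.le).trans measureReal_nonneg

theorem inducedDistribution_apply (μ : ProbabilityMeasure CDF) (r : Kernel CDF ℝ)
    [IsMarkovKernel r] (ω : ℝ) :
    inducedDistribution μ r ω = ∫ G, (r G).real (Iic ω) ∂(μ : Measure CDF) := by
  rw [inducedDistribution, cdf_eq_real, measureReal_def,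
    Measure.bind_apply measurableSet_Iic r.measurable.aemeasurable,
    ← integral_toReal (r.measurable_coe measurableSet_Iic).aemeasurable
      (Eventually.of_forall fun G => measure_lt_top _ _)]
  rfl

theorem quantileDistributions_subset (F : CDF) (τ : ℝ) (hτ : τ ∈ Ioo (0 : ℝ) 1) :
    quantileDistributions F τ ⊆ interval (rightTruncation F τ hτ) (leftTruncation F τ hτ) := by
  rintro H ⟨μ, hμ, r, hr, rfl⟩ ω
  have := hr.1
  have hint : Integrable (fun G : CDF => (r G).real (Iic ω)) (μ : Measure CDF) :=
    Integrable.of_bound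
      (r.measurable_coe measurableSet_Iic).ennreal_toReal.aestronglyMeasurable 1
      (Eventually.of_forall fun G => by
        rw [Real.norm_of_nonneg measureReal_nonneg]; exact measureReal_le_one)
  have hG := integrable_eval μ ω
  constructor
  · refine max_le ?_ (cdf_nonneg _ _)
    rw [inducedDistribution_apply]
    calc (F.1 ω - τ) / (1 - τ) = ∫ G : CDF, (G.1 ω - τ) / (1 - τ) ∂(μ : Measure CDF) := by
          rw [integral_div, integral_sub hG (integrable_const _), hμ ω]; simp
      _ ≤ _ := integral_mono ((hG.sub (integrable_const _)).div_const _) hint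
          fun G => le_selection_Iic hτ hr G ω
  · refine le_min ?_ (cdf_le_one _ _)
    rw [inducedDistribution_apply]
    calc _ ≤ ∫ G : CDF, 1 / τ * G.1 ω ∂(μ : Measure CDF) :=
          integral_mono hint (hG.const_mul _) fun G => selection_Iic_le hτ hr G ω
      _ = 1 / τ * F.1 ω := by rw [integral_const_mul, hμ ω]

/-! ### Two-point posteriors -/

/-- The distribution with an atom of mass `τ` at `a` and one of mass `1 - τ` at `b`. -/
noncomputable def binary {τ : ℝ} (hτ : τ ∈ Ioo (0 : ℝ) 1) (a b : ℝ) : MonoFun where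
  toFun x := τ * (Ici a).indicator 1 x + (1 - τ) * (Ici b).indicator 1 x
  mono' x y hxy := by
    have h (c : ℝ) : (Ici c).indicator (1 : ℝ → ℝ) x ≤ (Ici c).indicator 1 y := by
      by_cases hc : c ≤ x
      · simp [hc, hc.trans hxy]
      · rw [indicator_of_notMem (by simpa using hc)]
        exact indicator_nonneg (fun _ _ => zero_le_one) _
    exact add_le_add (mul_le_mul_of_nonneg_left (h a) hτ.1.le)
      (mul_le_mul_of_nonneg_left (h b) (sub_nonneg.2 hτ.2.le))
  right_continuous' x := by
    have h (c : ℝ) : ContinuousWithinAt ((Ici c).indicator (1 : ℝ → ℝ)) (Ici x) x := by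
      rcases le_or_gt c x with hc | hc
      · exact (continuousWithinAt_const (b := (1 : ℝ))).congr
          (fun y hy => by simp [hc.trans hy]) (by simp [hc])
      · refine ContinuousAt.continuousWithinAt ?_
        refine (continuousAt_const (y := (0 : ℝ))).congr ?_
        filter_upwards [gt_mem_nhds hc] with y hy
        simp [hy]
    exact (continuousWithinAt_const.mul (h a)).add (continuousWithinAt_const.mul (h b))

theorem binary_apply {τ : ℝ} (hτ : τ ∈ Ioo (0 : ℝ) 1) (a b x : ℝ) :
    binary hτ a b x = τ * (Ici a).indicator 1 x + (1 - τ) * (Ici b).indicator 1 x := rfl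

noncomputable def binaryCDF {τ : ℝ} (hτ : τ ∈ Ioo (0 : ℝ) 1) (a b : ℝ) : CDF :=
  ⟨binary hτ a b, by
    constructor
    · refine tendsto_const_nhds.congr' ?_
      filter_upwards [eventually_ge_atTop a, eventually_ge_atTop b] with x ha hb
      simp [binary_apply, ha, hb]
    · refine tendsto_const_nhds.congr' ?_
      filter_upwards [eventually_lt_atBot a, eventually_lt_atBot b] with x ha hb
      simp [binary_apply, ha, hb]⟩

/-- Both atoms have positive mass, so the function jumps by at least `min τ (1 - τ)` at each of
them. -/
theorem ne_of_continuousAt_binary {τ : ℝ} (hτ : τ ∈ Ioo (0 : ℝ) 1) {a b x : ℝ}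
    (hx : ContinuousAt (fun y : ℝ => binary hτ a b y) x) : x ≠ a ∧ x ≠ b := by
  have key : ∀ y < x, (x = a ∨ x = b) →
      binary hτ a b y ≤ binary hτ a b x - min τ (1 - τ) := by
    intro y hy hab
    have h (c : ℝ) : (Ici c).indicator (1 : ℝ → ℝ) y ≤ (Ici c).indicator 1 x := by
      by_cases hc : c ≤ y
      · simp [hc, hc.trans hy.le]
      · rw [indicator_of_notMem (by simpa using hc)]
        exact indicator_nonneg (fun _ _ => zero_le_one) _
    have ha := mul_le_mul_of_nonneg_left (h a) hτ.1.le
    have hb := mul_le_mul_of_nonneg_left (h b) (sub_nonneg.2 hτ.2.le)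
    rw [binary_apply, binary_apply]
    rcases hab with rfl | rfl
    · have h0 : (Ici x).indicator (1 : ℝ → ℝ) y = 0 := by simp [hy]
      have h1 : (Ici x).indicator (1 : ℝ → ℝ) x = 1 := by simp
      rw [h0, h1]
      linarith [min_le_left τ (1 - τ)]
    · have h0 : (Ici x).indicator (1 : ℝ → ℝ) y = 0 := by simp [hy]
      have h1 : (Ici x).indicator (1 : ℝ → ℝ) x = 1 := by simp
      rw [h0, h1]
      linarith [min_le_right τ (1 - τ)]
  by_contra hab
  have hab' : x = a ∨ x = b := by tauto
  have hle := le_of_tendsto (hx.tendsto.mono_left nhdsWithin_le_nhds)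
    (eventually_nhdsWithin_of_forall (s := Iio x) fun y hy => key y hy hab')
  linarith [lt_min hτ.1 (sub_pos.2 hτ.2)]

theorem tendsto_indicator_Ici {a : ℕ → ℝ} {a₀ x : ℝ} (ha : Tendsto a atTop (𝓝 a₀)) (hx : x ≠ a₀) :
    Tendsto (fun n => (Ici (a n)).indicator (1 : ℝ → ℝ) x) atTop
      (𝓝 ((Ici a₀).indicator 1 x)) := by
  refine tendsto_const_nhds.congr' ?_
  rcases lt_or_gt_of_ne hx with h | h
  · filter_upwards [ha.eventually (lt_mem_nhds h)] with n hn
    simp [h, hn]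
  · filter_upwards [ha.eventually (gt_mem_nhds h)] with n hn
    simp [h.le, hn.le]

/-- Open sets are defined by sequences, so sequential continuity suffices. It is tested only off the
limiting atoms, where the values are eventually constant. -/
theorem continuous_binary {τ : ℝ} (hτ : τ ∈ Ioo (0 : ℝ) 1) :
    Continuous fun p : ℝ × ℝ => binary hτ p.1 p.2 := by
  refine continuous_def.2 fun U hU => isClosed_compl_iff.1 ?_
  refine IsSeqClosed.isClosed fun p p₀ hp hlim hp₀ => ?_
  have hweak : WeakConv (fun n => binary hτ (p n).1 (p n).2) (binary hτ p₀.1 p₀.2) :=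
    fun x hx => by
      obtain ⟨h1, h2⟩ := ne_of_continuousAt_binary hτ hx
      exact ((tendsto_indicator_Ici (continuous_fst.tendsto _ |>.comp hlim) h1).const_mul _).add
        ((tendsto_indicator_Ici (continuous_snd.tendsto _ |>.comp hlim) h2).const_mul _)
  obtain ⟨n, hn⟩ := (hU _ hp₀ _ hweak).exists
  exact hp n hn

theorem measurable_binaryCDF {τ : ℝ} (hτ : τ ∈ Ioo (0 : ℝ) 1) :
    Measurable fun p : ℝ × ℝ => binaryCDF hτ p.1 p.2 :=
  (continuous_binary hτ).measurable.subtype_mk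

theorem Icc_subset_quantileSet_binaryCDF {τ : ℝ} (hτ : τ ∈ Ioo (0 : ℝ) 1) (a b : ℝ) :
    Icc a b ⊆ quantileSet τ (binaryCDF hτ a b) := by
  refine Icc_subset_Icc ((quantile_le_iff _ hτ a).2 ?_) (le_rightLim_quantile _ hτ fun ω hω => ?_)
  · have h0 : 0 ≤ (Ici b).indicator (1 : ℝ → ℝ) a := indicator_nonneg (fun _ _ => zero_le_one) _
    have := mul_nonneg (sub_nonneg.2 hτ.2.le) h0
    simpa [binaryCDF, binary_apply] using this
  · have h1 : (Ici a).indicator (1 : ℝ → ℝ) ω ≤ 1 := indicator_le_self' (fun _ _ => zero_le_one) _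
    have := mul_le_mul_of_nonneg_left h1 hτ.1.le
    simpa [binaryCDF, binary_apply, hω] using this

/-- If the random variable `Y` is almost surely a `τ`-quantile of the random CDF `X`, then the law
of `Y` is induced by the law of `X` and some selection rule. -/
theorem exists_selectionRule {Ω : Type*} [MeasurableSpace Ω] (P : Measure Ω)
    [IsProbabilityMeasure P] {τ : ℝ} (hτ : τ ∈ Ioo (0 : ℝ) 1) {X : Ω → CDF} {Y : Ω → ℝ}
    (hX : Measurable X) (hY : Measurable Y) (hXY : ∀ᵐ u ∂P, Y u ∈ quantileSet τ (X u)) :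
    ∃ r ∈ selectionRules τ, (P.map X).bind r = P.map Y := by
  classical
  have : IsProbabilityMeasure (P.map X) := Measure.isProbabilityMeasure_map hX.aemeasurable
  set κ := condDistrib Y X P
  have hS := measurableSet_graph_quantileSet hτ
  have hmeas : MeasurableSet {G : CDF | κ G (quantileSet τ G) = 1} :=
    Kernel.measurable_kernel_prodMk_left (κ := κ) hS (measurableSet_singleton 1)
  -- The conditional law is supported on quantiles only almost surely; `d` replaces it on the
  -- exceptional null set.
  let d : Kernel CDF ℝ := Kernel.deterministic (fun G => quantile G τ) (measurable_quantile hτ)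
  have hae : ∀ᵐ G ∂(P.map X), κ G (quantileSet τ G) = 1 := by
    have h : ∀ᵐ p ∂((P.map X) ⊗ₘ κ), p.2 ∈ quantileSet τ p.1 := by
      rw [compProd_map_condDistrib hY.aemeasurable,
        ae_map_iff (hX.prodMk hY).aemeasurable hS]
      exact hXY
    filter_upwards [Measure.ae_ae_of_ae_compProd h] with G hG
    exact (mem_ae_iff_prob_eq_one measurableSet_Icc).1 hG
  refine ⟨Kernel.piecewise hmeas κ d, ⟨inferInstance, fun G => ?_⟩, ?_⟩
  · rw [Kernel.piecewise_apply']
    split_ifs with h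
    · exact h
    · rw [quantileSet, Kernel.deterministic_apply' _ _ measurableSet_Icc]
      exact indicator_of_mem (show _ ∈ Icc _ _ from ⟨le_rfl, quantile_le_rightLim G hτ⟩) _
  · rw [← condDistrib_comp_map hX.aemeasurable hY.aemeasurable]
    refine Measure.bind_congr_right ?_
    filter_upwards [hae] with G hG
    rw [Kernel.piecewise_apply]
    exact if_pos hG

/-! ### Sufficiency by quantile coupling -/

/-- The uniform distribution on the open unit interval. -/
noncomputable def uniformIoo : Measure (Ioo (0 : ℝ) 1) := Measure.comap Subtype.val volume

instance isProbabilityMeasure_uniformIoo : IsProbabilityMeasure uniformIoo :=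
  ⟨by
    rw [uniformIoo, comap_subtype_coe_apply measurableSet_Ioo, image_univ, Subtype.range_coe]
    simp⟩

theorem uniformIoo_real_le (c : ℝ) :
    uniformIoo.real {u | (u : ℝ) ≤ c} = max (min c 1) 0 := by
  have h : Subtype.val '' {u : Ioo (0 : ℝ) 1 | (u : ℝ) ≤ c} = Ioo 0 1 ∩ Iic c := by
    ext x; simp [and_comm]
  rw [measureReal_def, uniformIoo, comap_subtype_coe_apply measurableSet_Ioo, h]
  have h2 : (volume (Ioo (0 : ℝ) 1 ∩ Iic c)) = volume (Ioc (0 : ℝ) (min c 1)) := by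
    rw [min_comm, ← Ioc_inter_Iic]
    exact measure_congr (Ioo_ae_eq_Ioc.inter (ae_eq_refl _))
  rw [h2, Real.volume_Ioc, sub_zero, ENNReal.toReal_ofReal']

/-- The subtype domain makes the composite monotone everywhere, hence measurable. -/
theorem measurable_quantile_comp (G : CDF) {f : Ioo (0 : ℝ) 1 → ℝ} (hf : Monotone f)
    (hf' : ∀ u, f u ∈ Ioo (0 : ℝ) 1) : Measurable fun u => quantile G (f u) :=
  Monotone.measurable fun _ _ h => monotoneOn_quantile G (hf' _) (hf' _) (hf h)

theorem map_quantile_cdf (G : CDF) :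
    cdf (uniformIoo.map fun u : Ioo (0 : ℝ) 1 => quantile G u) = G.1 := by
  have hm : Measurable fun u : Ioo (0 : ℝ) 1 => quantile G u :=
    measurable_quantile_comp G (fun _ _ h => h) fun u => u.2
  have := Measure.isProbabilityMeasure_map (μ := uniformIoo) hm.aemeasurable
  ext ω
  rw [cdf_eq_real, map_measureReal_apply hm measurableSet_Iic]
  have : (fun u : Ioo (0 : ℝ) 1 => quantile G u) ⁻¹' Iic ω =
      {u : Ioo (0 : ℝ) 1 | (u : ℝ) ≤ G.1 ω} :=
    Set.ext fun u => quantile_le_iff G u.2 ω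
  rw [this, uniformIoo_real_le, min_eq_left (G.le_one ω), max_eq_left (G.nonneg ω)]

theorem interval_subset (F : CDF) (τ : ℝ) (hτ : τ ∈ Ioo (0 : ℝ) 1) :
    interval (rightTruncation F τ hτ) (leftTruncation F τ hτ) ⊆ quantileDistributions F τ := by
  intro H hH
  have hτ' : 0 < 1 - τ := sub_pos.2 hτ.2
  have hlow (x : ℝ) : max ((F.1 x - τ) / (1 - τ)) 0 ≤ H x := (hH x).1
  have hup (x : ℝ) : H x ≤ min (1 / τ * F.1 x) 1 := (hH x).2
  have hHtop : Tendsto (fun x : ℝ => H x) atTop (𝓝 1) := by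
    refine tendsto_of_tendsto_of_tendsto_of_le_of_le
      ?_ tendsto_const_nhds (fun x => (le_max_left _ _).trans (hlow x))
      (fun x => (hup x).trans (min_le_right _ _))
    simpa [div_self hτ'.ne'] using (F.2.1.sub_const τ).div_const (1 - τ)
  have hHbot : Tendsto (fun x : ℝ => H x) atBot (𝓝 0) := by
    refine tendsto_of_tendsto_of_tendsto_of_le_of_le
      tendsto_const_nhds ?_ (fun x => (le_max_right _ _).trans (hlow x))
      (fun x => (hup x).trans (min_le_left _ _))
    simpa using F.2.2.const_mul (1 / τ)
  let K : CDF := ⟨H, hHtop, hHbot⟩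
  let P := uniformIoo
  have hl (u : Ioo (0 : ℝ) 1) : τ * u ∈ Ioo (0 : ℝ) 1 :=
    ⟨mul_pos hτ.1 u.2.1, by nlinarith [hτ.1, hτ.2, u.2.1, u.2.2]⟩
  have hh (u : Ioo (0 : ℝ) 1) : τ + (1 - τ) * u ∈ Ioo (0 : ℝ) 1 :=
    ⟨by nlinarith [hτ.1, mul_pos hτ' u.2.1], by nlinarith [mul_lt_mul_of_pos_left u.2.2 hτ']⟩
  -- These are the quantile functions of the left and right truncations, written through that of
  -- `F`.
  let a : Ioo (0 : ℝ) 1 → ℝ := fun u => quantile F (τ * u)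
  let b : Ioo (0 : ℝ) 1 → ℝ := fun u => quantile F (τ + (1 - τ) * u)
  have ha : Measurable a := measurable_quantile_comp F
    (fun _ _ h => mul_le_mul_of_nonneg_left (Subtype.coe_le_coe.2 h) hτ.1.le) hl
  have hb : Measurable b := measurable_quantile_comp F
    (fun _ _ h => add_le_add_right (mul_le_mul_of_nonneg_left (Subtype.coe_le_coe.2 h) hτ'.le) _) hh
  let X : Ioo (0 : ℝ) 1 → CDF := fun u => binaryCDF hτ (a u) (b u)
  have hX : Measurable X := (measurable_binaryCDF hτ).comp (ha.prodMk hb)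
  let Y : Ioo (0 : ℝ) 1 → ℝ := fun u => quantile K u
  have hY : Measurable Y := measurable_quantile_comp K (fun _ _ h => h) fun u => u.2
  have hXY (u : Ioo (0 : ℝ) 1) : Y u ∈ quantileSet τ (X u) := by
    refine Icc_subset_quantileSet_binaryCDF hτ _ _ ⟨?_, ?_⟩
    · refine (quantile_le_iff F (hl u) _).2 ?_
      have h1 : (u : ℝ) ≤ 1 / τ * F.1 (Y u) :=
        ((quantile_le_iff K u.2 _).1 le_rfl).trans ((hup _).trans (min_le_left _ _))
      rw [one_div, inv_mul_eq_div, le_div_iff₀ hτ.1] at h1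
      linarith
    · refine (quantile_le_iff K u.2 _).2 (le_trans ?_ ((le_max_left _ _).trans (hlow _)))
      have h1 : τ + (1 - τ) * u ≤ F.1 (b u) := (quantile_le_iff F (hh u) _).1 le_rfl
      rw [le_div_iff₀ hτ']
      linarith
  obtain ⟨r, hr, hbind⟩ := exists_selectionRule P hτ hX hY (Eventually.of_forall hXY)
  have hprob : IsProbabilityMeasure (P.map X) := Measure.isProbabilityMeasure_map hX.aemeasurable
  refine ⟨⟨P.map X, hprob⟩, fun ω => ?_, r, hr, ?_⟩
  · change ∫ G : CDF, G.1 ω ∂(P.map X) = F.1 ω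
    rw [integral_map hX.aemeasurable (measurable_eval ω).aestronglyMeasurable]
    have hset_a : MeasurableSet {u | a u ≤ ω} := ha measurableSet_Iic
    have hset_b : MeasurableSet {u | b u ≤ ω} := hb measurableSet_Iic
    have hfun : (fun u => (X u).1 ω) = fun u =>
        τ * {u | a u ≤ ω}.indicator 1 u + (1 - τ) * {u | b u ≤ ω}.indicator 1 u := rfl
    have hia : Integrable ({u | a u ≤ ω}.indicator (1 : Ioo (0 : ℝ) 1 → ℝ)) P :=
      (integrable_const (1 : ℝ)).indicator hset_a
    have hib : Integrable ({u | b u ≤ ω}.indicator (1 : Ioo (0 : ℝ) 1 → ℝ)) P :=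
      (integrable_const (1 : ℝ)).indicator hset_b
    have hPa : P.real {u | a u ≤ ω} = max (min (F.1 ω / τ) 1) 0 := by
      rw [← uniformIoo_real_le]
      congr 1
      ext u
      exact (quantile_le_iff F (hl u) ω).trans (by rw [mem_ofPred_eq, le_div_iff₀' hτ.1])
    have hPb : P.real {u | b u ≤ ω} = max (min ((F.1 ω - τ) / (1 - τ)) 1) 0 := by
      rw [← uniformIoo_real_le]
      congr 1
      ext u
      exact (quantile_le_iff F (hh u) ω).trans
        (by rw [mem_ofPred_eq, le_div_iff₀' hτ', le_sub_iff_add_le'])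
    rw [hfun, integral_add (hia.const_mul _) (hib.const_mul _), integral_const_mul,
      integral_const_mul, integral_indicator_one hset_a, integral_indicator_one hset_b, hPa, hPb]
    have h0 := F.nonneg ω
    have h1 := F.le_one ω
    rw [max_eq_left (le_min (div_nonneg h0 hτ.1.le) zero_le_one),
      min_eq_left ((div_le_one hτ').2 (by linarith))]
    -- Below `τ` the right truncation is `0`; above `τ` the left truncation is `1`.
    rcases le_total (F.1 ω) τ with h | h
    · rw [min_eq_left ((div_le_one hτ.1).2 h),
        max_eq_right (div_nonpos_of_nonpos_of_nonneg (by linarith) hτ'.le), mul_div_cancel₀ _ hτ.1.ne']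
      ring
    · rw [min_eq_right ((one_le_div hτ.1).2 h), max_eq_left (div_nonneg (by linarith) hτ'.le),
        mul_div_cancel₀ _ hτ'.ne']
      ring
  · change H = cdf ((P.map X).bind r)
    rw [hbind]
    exact (map_quantile_cdf K).symm

end PosteriorQuantile

theorem theorem2 (F : PosteriorQuantile.CDF) (τ : ℝ) (hτ : τ ∈ Set.Ioo (0 : ℝ) 1) :
    PosteriorQuantile.quantileDistributions F τ =
      PosteriorQuantile.interval (PosteriorQuantile.rightTruncation F τ hτ)
        (PosteriorQuantile.leftTruncation F τ hτ) :=
  (PosteriorQuantile.quantileDistributions_subset F τ hτ).antisymm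
    (PosteriorQuantile.interval_subset F τ hτ)
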